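/- Let $W:[0,1]^2\to[0,1]$ be a graphon (symmetric, measurable) with degree function $d(x)=\int_0^1 W(x,y)\,dy$ and with $T_W$ the integral operator $(T_Wf)(x)=\int_0^1W(x,y)f(y)\,dy$ on $L^2[0,1]$, with operator norm $\|T_W\|=\sup_{\|f\|_2=1}\|T_Wf\|_2$. Suppose that - $W$ is piecewise Lipschitz: there are $L\in\mathbb R$, an integer $K\ge 0$ and $0=\alpha_0<\dots<\alpha_{K+1}=1$ such that, with $I_k=[\alpha_{k-1},\alpha_k)$, for all $k,\ell$ and all $(x_1,y_1),(x_2,y_2)\in I_k\times I_\ell$, $|W(x_1,y_1)-W(x_2,y_2)|\le L(|x_1-x_2|+|y_1-y_2|)$; - $W$ is non-decreasing: $W(x_1,y)\le W(x_2,y)$ whenever $x_1\le x_2$; - the minimum $\eta_W$ of $W$ is strictly positive. Let $\nu<e^{-1}$ and let $N\ge 1$ be large enough in the sense that $$\frac2N<\min_{1\le k\le K+1}(\alpha_k-\alpha_{k-1}),\qquad \frac1N\log\frac{2N}{\nu}+\frac{2K+3L}{N}<\max_x d(x),\qquad Ne^{-N/5}<\nu .$$ Put $$b_N=\frac1N+\sqrt{\frac{8\log(N/\nu)}{N+1}},\qquad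 \vartheta(N)=2\sqrt{(L^2-K^2)b_N^2+Kb_N},\qquad \varphi(N)=\Big(\frac1{\sqrt{\eta_W}}+2\Big)\sqrt{\frac{\log(2N/\nu)}{N}},$$ and assume moreover that $2Kb_N\le1$ or $K\le L$. Let $X_1,\dots,X_N$ be independent and uniform on $[0,1]$ with order statistics $X_{(1)}\le\dots\le X_{(N)}$, and let $G_N$ be the random simple graph on $\{1,\dots,N\}$ in which, conditionally on $X_1,\dots,X_N$, the pairs $i\ne j$ are connected independently with probability $W(X_{(i)},X_{(j)})$. Let $\lambda_1\le\dots\le\lambda_N$ be the eigenvalues of the Laplacian matrix of $G_N$, $\mu_i=\lambda_i/N$, and $\mu_N(x)=\sum_{i=1}^N\mu_i\mathbf 1_{B_i}(x)$, where $B_i=[(i-1)/N,i/N)$ for $i<N$ and $B_N=[(N-1)/N,1]$. Then, with probability at least $1-3\nu$, $$\|\mu_N-d\|_2\le\varphi(N)+\sqrt[4]{\frac2N}\,\sqrt{\|T_W\|+\vartheta(N)}+\vartheta(N).$$ -/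

import Mathlib

open MeasureTheory ProbabilityTheory

noncomputable section

namespace GraphonSpectrum

/-- A graphon: a symmetric measurable function on the unit square with values in `[0,1]`. -/
structure IsGraphon (W : unitInterval → unitInterval → ℝ) : Prop where
  measurable : Measurable (Function.uncurry W)
  symm : ∀ x y, W x y = W y x
  nonneg : ∀ x y, 0 ≤ W x y
  le_one : ∀ x y, W x y ≤ 1

/-- The degree function `d(x) = ∫ W(x,y) dy`. -/
def degreeFn (W : unitInterval → unitInterval → ℝ) (x : unitInterval) : ℝ :=
  ∫ y, W x y

/-- The infimum of the graphon over the unit square. -/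
def infW (W : unitInterval → unitInterval → ℝ) : ℝ :=
  sInf (Set.range (Function.uncurry W))

/-- The integral operator `(T_W f)(x) = ∫ W(x,y) f(y) dy`. -/
def integralOp (W : unitInterval → unitInterval → ℝ) (f : unitInterval → ℝ)
    (x : unitInterval) : ℝ :=
  ∫ y, W x y * f y

/-- The operator norm of `T_W` on `L²[0,1]`: the supremum of `‖T_W f‖₂` over `‖f‖₂ = 1`. -/
def opNorm (W : unitInterval → unitInterval → ℝ) : ℝ :=
  (⨆ (f : Lp ℝ 2 (volume : Measure unitInterval)) (_ : ‖f‖ = 1),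
    eLpNorm (integralOp W f) 2 volume).toReal

/-- `W` is piecewise Lipschitz with constant `L` on the partition
`0 = α₀ < ⋯ < α_{K+1} = 1` into the intervals `[α_{k-1}, α_k)`. -/
structure IsPiecewiseLipschitz (W : unitInterval → unitInterval → ℝ) (L : ℝ) (K : ℕ)
    (α : Fin (K + 2) → ℝ) : Prop where
  strictMono : StrictMono α
  first : α 0 = 0
  last : α (Fin.last (K + 1)) = 1
  lipschitz : ∀ k l : Fin (K + 1), ∀ x₁ x₂ y₁ y₂ : unitInterval,
    (x₁ : ℝ) ∈ Set.Ico (α k.castSucc) (α k.succ) →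
    (x₂ : ℝ) ∈ Set.Ico (α k.castSucc) (α k.succ) →
    (y₁ : ℝ) ∈ Set.Ico (α l.castSucc) (α l.succ) →
    (y₂ : ℝ) ∈ Set.Ico (α l.castSucc) (α l.succ) →
    |W x₁ y₁ - W x₂ y₂| ≤ L * (|(x₁ : ℝ) - x₂| + |(y₁ : ℝ) - y₂|)

/-- The three conditions under which `N` is called large enough (for given `ν`). -/
structure LargeEnough (W : unitInterval → unitInterval → ℝ) (L : ℝ) (K : ℕ)
    (α : Fin (K + 2) → ℝ) (ν : ℝ) (N : ℕ) : Prop where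
  gap : ∀ k : Fin (K + 1), 2 / (N : ℝ) < α k.succ - α k.castSucc
  degree : 1 / (N : ℝ) * Real.log (2 * N / ν) + 1 / (N : ℝ) * (2 * K + 3 * L) <
    sSup (Set.range (degreeFn W))
  tail : (N : ℝ) * Real.exp (-(N : ℝ) / 5) < ν

/-- `b_N = 1/N + √(8 log(N/ν)/(N+1))`. -/
def bN (ν : ℝ) (N : ℕ) : ℝ :=
  1 / (N : ℝ) + Real.sqrt (8 * Real.log (N / ν) / (N + 1))

/-- `ϑ(N) = 2 √((L² - K²) b_N² + K b_N)`. -/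
def thetaN (L : ℝ) (K : ℕ) (ν : ℝ) (N : ℕ) : ℝ :=
  2 * Real.sqrt ((L ^ 2 - (K : ℝ) ^ 2) * bN ν N ^ 2 + K * bN ν N)

/-- `φ(N) = (1/√η + 2) √(log(2N/ν)/N)`. -/
def phiN (η ν : ℝ) (N : ℕ) : ℝ :=
  (1 / Real.sqrt η + 2) * Real.sqrt (Real.log (2 * N / ν) / N)

/-- The order statistics: the points `x` rearranged in non-decreasing order. -/
def orderStat {N : ℕ} (x : Fin N → unitInterval) (i : Fin N) : unitInterval :=
  x (Tuple.sort x i)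

/-- The weighted adjacency matrix with entries `W(x_(i), x_(j))`. -/
def weightedAdj (W : unitInterval → unitInterval → ℝ) {N : ℕ} (x : Fin N → unitInterval) :
    Matrix (Fin N) (Fin N) ℝ :=
  fun i j => W (orderStat x i) (orderStat x j)

open Classical in
/-- The probability of the simple graph `H` when every pair `i < j` is connected independently
with probability `W(x_(i), x_(j))`. -/
def graphProb (W : unitInterval → unitInterval → ℝ) {N : ℕ} (x : Fin N → unitInterval)
    (H : SimpleGraph (Fin N)) : ℝ :=
  ∏ p : Fin N × Fin N with p.1 < p.2,
    if H.Adj p.1 p.2 then weightedAdj W x p.1 p.2 else 1 - weightedAdj W x p.1 p.2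

/-- `G` is the random simple graph on `N` vertices sampled from `W` with latent variables `X`:
the `X i` are independent and uniform on `[0,1]`, and conditionally on `X` the graph `G` has the
law `graphProb W X`. -/
structure IsSampledGraph {Ω : Type*} [MeasurableSpace Ω] (P : Measure Ω)
    (W : unitInterval → unitInterval → ℝ) {N : ℕ}
    (X : Fin N → Ω → unitInterval) (G : Ω → SimpleGraph (Fin N)) : Prop where
  measurable_latent : ∀ i, Measurable (X i)
  indep : iIndepFun X P
  uniform : ∀ i, P.map (X i) = volume
  measurable_graph : ∀ H, MeasurableSet {ω | G ω = H}
  cond_law : ∀ (H : SimpleGraph (Fin N)) (B : Set (Fin N → unitInterval)), MeasurableSet B →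
    P ({ω | (fun i => X i ω) ∈ B} ∩ {ω | G ω = H}) =
      ∫⁻ ω in {ω | (fun i => X i ω) ∈ B}, ENNReal.ofReal (graphProb W (fun i => X i ω) H) ∂P

open Classical in
/-- The Laplacian eigenvalues of `G`, with multiplicity. -/
def lapEig {N : ℕ} (G : SimpleGraph (Fin N)) : Fin N → ℝ :=
  (G.posSemidef_lapMatrix ℝ).isHermitian.eigenvalues

/-- The normalized Laplacian eigenvalues `μ_i = λ_i / N`, in non-decreasing order. -/
def normEig {N : ℕ} (G : SimpleGraph (Fin N)) (i : Fin N) : ℝ :=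
  lapEig G (Tuple.sort (lapEig G) i) / N

/-- The uniform partition of `[0,1]` into the intervals `[i/N, (i+1)/N)` for `0 ≤ i < N`,
the last one closed. -/
def block (N : ℕ) (i : Fin N) : Set unitInterval :=
  {x | (i : ℝ) / N ≤ x ∧ ((x : ℝ) < ((i : ℝ) + 1) / N ∨ (i : ℕ) + 1 = N)}

/-- The step function of the sorted normalized Laplacian eigenvalues. -/
def muStep {N : ℕ} (G : SimpleGraph (Fin N)) (x : unitInterval) : ℝ :=
  ∑ i : Fin N, (block N i).indicator (fun _ => normEig G i) x

end GraphonSpectrum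

end

/-! Write c_i = d(X_(i)), which is non-decreasing in i because d is monotone, and split μ_N - d into
μ_N minus the step function of c, plus that step function minus d. The first piece costs φ(N) and
the second ϑ(N); the operator-norm term is nonnegative and serves only as slack.

Spectral piece. By Hoffman–Wielandt (`sum_sq_sort_eigenvalues_sub_le`), the squared distance from
the sorted Laplacian eigenvalues to the sorted vector N c is at most the squared Frobenius norm of D
- A - diag(N c). The adjacency part has at most N² entries of modulus 1, so after normalization it
costs only 1/N in squared L² norm. The diagonal part is degree concentration: Hoeffding for the
edges given the latent points, then Hoeffding for the average of W(X_j, X_k) over k ≠ j given X_j.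
Since φ(N) ≥ 3√(log(2N/ν)/N), both costs fit inside φ(N).

Sampling piece. Hoeffding for the empirical distribution function at 2N points puts every order
statistic within b_N of its whole block. There d is L-Lipschitz except near K breakpoints, where the
squared error is at most 1 on a set of measure at most 2b_N each. This gives min(1, L²b² + 2Kb) ≤
ϑ(N)².

The failure probabilities are ν for edges, ν for averages and ν/2 for each side of the order
statistics. -/

noncomputable section

namespace GraphonSpectrum

/-! ### Hoffman–Wielandt and the Laplacian spectrum -/

/-- The rearrangement inequality for doubly stochastic matrices. -/
theorem sum_doublyStochastic_mul_le {n : ℕ} {S : Matrix (Fin n) (Fin n) ℝ}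
    (hS : S ∈ doublyStochastic ℝ (Fin n)) (a : Fin n → ℝ) {c : Fin n → ℝ} (hc : Monotone c) :
    ∑ i, ∑ k, S i k * a k * c i ≤ ∑ i, a (Tuple.sort a i) * c i := by
  -- Birkhoff–von Neumann: the sum is linear in S, so permutation matrices suffice, and for those
  -- the similarly ordered pairing is the largest.
  obtain ⟨w, hw0, hw1, rfl⟩ := exists_eq_sum_perm_of_mem_doublyStochastic hS
  have key : ∀ σ : Equiv.Perm (Fin n), ∑ i, a (σ i) * c i ≤ ∑ i, a (Tuple.sort a i) * c i := by
    intro σ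
    have h := ((Tuple.monotone_sort a).monovary hc).sum_comp_perm_mul_le_sum_mul
      (σ := σ.trans (Tuple.sort a).symm)
    simpa using h
  calc ∑ i, ∑ k, (∑ σ, w σ • Equiv.Perm.permMatrix ℝ σ) i k * a k * c i
      = ∑ σ, w σ * ∑ i, a (σ i) * c i := by
        simp only [Matrix.sum_apply, Matrix.smul_apply, Finset.sum_mul, Finset.mul_sum]
        rw [Finset.sum_congr rfl fun i _ => Finset.sum_comm, Finset.sum_comm]
        refine Finset.sum_congr rfl fun σ _ => Finset.sum_congr rfl fun i _ => ?_
        rw [Finset.sum_eq_single (σ i)]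
        · simp [Equiv.Perm.permMatrix, PEquiv.toMatrix_apply, mul_assoc]
        · intro k _ hk
          simp [Equiv.Perm.permMatrix, PEquiv.toMatrix_apply, Ne.symm hk]
        · simp
    _ ≤ ∑ σ, w σ * ∑ i, a (Tuple.sort a i) * c i := by
        exact Finset.sum_le_sum fun σ _ => mul_le_mul_of_nonneg_left (key σ) (hw0 σ)
    _ = _ := by rw [← Finset.sum_mul, hw1, one_mul]

/-- The spectral theorem entrywise. On the diagonal it exhibits A i i as an average of the
eigenvalues with squared eigenvector entries as weights. -/
theorem isHermitian_apply_eq_sum {n : ℕ} {A : Matrix (Fin n) (Fin n) ℝ} (hA : A.IsHermitian)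
    (i j : Fin n) :
    A i j = ∑ k, hA.eigenvectorUnitary.1 i k * hA.eigenvalues k * hA.eigenvectorUnitary.1 j k := by
  conv_lhs => rw [hA.spectral_theorem, Unitary.conjStarAlgAut_apply]
  simp [Matrix.mul_apply, Matrix.diagonal_apply, Matrix.star_apply]

/-- Rows and columns of an orthogonal matrix are unit vectors. -/
theorem sq_eigenvectorUnitary_mem_doublyStochastic {n : ℕ} {A : Matrix (Fin n) (Fin n) ℝ}
    (hA : A.IsHermitian) :
    (Matrix.of fun i k => (hA.eigenvectorUnitary.1 i k) ^ 2) ∈ doublyStochastic ℝ (Fin n) := by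
  rw [mem_doublyStochastic_iff_sum]
  refine ⟨fun i j => sq_nonneg _, fun i => ?_, fun j => ?_⟩
  · have h := congrFun (congrFun (Matrix.mem_unitaryGroup_iff.1 hA.eigenvectorUnitary.2) i) i
    simpa [Matrix.mul_apply, Matrix.star_apply, sq] using h
  · have h := congrFun (congrFun (Matrix.mem_unitaryGroup_iff'.1 hA.eigenvectorUnitary.2) j) j
    simpa [Matrix.mul_apply, Matrix.star_apply, sq] using h

/-- Both sides are the trace of A², which is invariant under conjugation. -/
theorem sum_sq_eq_sum_eigenvalues_sq {n : ℕ} {A : Matrix (Fin n) (Fin n) ℝ}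
    (hA : A.IsHermitian) : ∑ i, ∑ j, A i j ^ 2 = ∑ k, hA.eigenvalues k ^ 2 := by
  have h1 : ∑ i, ∑ j, A i j ^ 2 = (A * A).trace := by
    simp only [Matrix.trace, Matrix.diag_apply, Matrix.mul_apply]
    refine Finset.sum_congr rfl fun i _ => Finset.sum_congr rfl fun j _ => ?_
    have := hA.apply i j
    simp only [star_trivial] at this
    rw [this, sq]
  have h2 : A * A = Unitary.conjStarAlgAut ℝ (Matrix (Fin n) (Fin n) ℝ) hA.eigenvectorUnitary
      (Matrix.diagonal fun k => hA.eigenvalues k ^ 2) := by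
    conv_lhs => rw [hA.spectral_theorem]
    rw [← map_mul, Matrix.diagonal_mul_diagonal]
    congr 2
    ext k
    simp [sq]
  rw [h1, h2, Unitary.conjStarAlgAut_apply, Matrix.trace_mul_comm, ← mul_assoc,
    Matrix.mem_unitaryGroup_iff'.1 hA.eigenvectorUnitary.2, one_mul, Matrix.trace_diagonal]

/-- The Hoffman–Wielandt inequality for a Hermitian matrix and a sorted diagonal matrix. -/
theorem sum_sq_sort_eigenvalues_sub_le {n : ℕ} {A : Matrix (Fin n) (Fin n) ℝ}
    (hA : A.IsHermitian) {c : Fin n → ℝ} (hc : Monotone c) :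
    ∑ i, (hA.eigenvalues (Tuple.sort hA.eigenvalues i) - c i) ^ 2 ≤
      ∑ i, ∑ j, (A i j - Matrix.diagonal c i j) ^ 2 := by
  -- After expanding the squares, the two sides of the goal differ only in this cross term.
  have hcross : ∑ i, A i i * c i ≤
      ∑ i, hA.eigenvalues (Tuple.sort hA.eigenvalues i) * c i := by
    refine le_trans (le_of_eq ?_) (sum_doublyStochastic_mul_le
      (sq_eigenvectorUnitary_mem_doublyStochastic hA) hA.eigenvalues hc)
    refine Finset.sum_congr rfl fun i _ => ?_
    rw [isHermitian_apply_eq_sum hA i i, Finset.sum_mul]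
    refine Finset.sum_congr rfl fun k _ => ?_
    simp only [Matrix.of_apply]
    ring
  have hl : ∑ i, hA.eigenvalues (Tuple.sort hA.eigenvalues i) ^ 2 = ∑ i, ∑ j, A i j ^ 2 := by
    rw [sum_sq_eq_sum_eigenvalues_sq hA]
    exact Equiv.sum_comp (Tuple.sort hA.eigenvalues) fun k => hA.eigenvalues k ^ 2
  have hr : ∑ i, ∑ j, (A i j - Matrix.diagonal c i j) ^ 2 =
      ∑ i, ∑ j, A i j ^ 2 - 2 * ∑ i, A i i * c i + ∑ i, c i ^ 2 := by
    rw [Finset.mul_sum, ← Finset.sum_sub_distrib, ← Finset.sum_add_distrib]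
    refine Finset.sum_congr rfl fun i _ => ?_
    have : ∀ j, (A i j - Matrix.diagonal c i j) ^ 2 =
        A i j ^ 2 + if i = j then - 2 * (A i i * c i) + c i ^ 2 else 0 := by
      intro j
      by_cases h : i = j
      · subst h; simp; ring
      · simp [h]
    simp only [this, Finset.sum_add_distrib, Finset.sum_ite_eq, Finset.mem_univ, if_true]
    ring
  rw [hr, ← hl]
  simp only [sub_sq, Finset.sum_add_distrib, Finset.sum_sub_distrib, mul_assoc, ← Finset.mul_sum]
  linarith

open Classical in
/-- Comparison of the sorted normalized Laplacian eigenvalues with a sorted vector that is close to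
the normalized degrees. -/
theorem sum_sq_normEig_sub_le {N : ℕ} (hN : 0 < N) (G : SimpleGraph (Fin N)) {c : Fin N → ℝ}
    (hc : Monotone c) {a : ℝ} (ha : ∀ i, |(G.degree i : ℝ) / N - c i| ≤ a) :
    ∑ i, (normEig G i - c i) ^ 2 ≤ N * a ^ 2 + 1 := by
  have hN' : (0 : ℝ) < N := by exact_mod_cast hN
  have hc' : Monotone fun i => N * c i := fun i j h => by
    have := hc h
    simp only
    gcongr
  have h := sum_sq_sort_eigenvalues_sub_le (G.posSemidef_lapMatrix ℝ).isHermitian hc'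
  have h1 : ∑ i, (normEig G i - c i) ^ 2 =
      (∑ i, (lapEig G (Tuple.sort (lapEig G) i) - N * c i) ^ 2) / N ^ 2 := by
    rw [Finset.sum_div]
    refine Finset.sum_congr rfl fun i _ => ?_
    unfold normEig
    field_simp
  have h2 : ∑ i, ∑ j, (G.lapMatrix ℝ i j - Matrix.diagonal (fun i => N * c i) i j) ^ 2 ≤
      N ^ 2 * (N * a ^ 2 + 1) := by
    have hrow : ∀ i, ∑ j, (G.lapMatrix ℝ i j - Matrix.diagonal (fun i => N * c i) i j) ^ 2 ≤
        N ^ 2 * a ^ 2 + N := by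
      intro i
      -- Off-diagonal Laplacian entries are 0 or -1, so the adjacency matrix contributes at most 1
      -- per entry.
      have hterm : ∀ j, (G.lapMatrix ℝ i j - Matrix.diagonal (fun i => N * c i) i j) ^ 2 ≤
          (if i = j then (N : ℝ) ^ 2 * a ^ 2 else 0) + 1 := by
        intro j
        by_cases hij : i = j
        · subst hij
          have h3 := sq_le_sq' (abs_le.1 (ha i)).1 (abs_le.1 (ha i)).2
          have h4 : G.lapMatrix ℝ i i - Matrix.diagonal (fun i => N * c i) i i =
              N * ((G.degree i : ℝ) / N - c i) := by
            simp [SimpleGraph.lapMatrix, SimpleGraph.degMatrix]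
            field_simp
          rw [h4, mul_pow, if_pos rfl]
          nlinarith [sq_nonneg (N : ℝ)]
        · simp only [SimpleGraph.lapMatrix, SimpleGraph.degMatrix, Matrix.sub_apply, hij,
            Matrix.diagonal_apply_ne _ hij, SimpleGraph.adjMatrix_apply, if_false]
          split_ifs <;> norm_num
      refine (Finset.sum_le_sum fun j _ => hterm j).trans (le_of_eq ?_)
      simp [Finset.sum_add_distrib]
    refine (Finset.sum_le_sum fun i _ => hrow i).trans (le_of_eq ?_)
    simp
    ring
  rw [h1, div_le_iff₀ (by positivity)]
  refine (h.trans h2).trans (le_of_eq (by ring))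

/-! ### Hoeffding's inequality and graphs with independent edges -/

/-- The two-sided Hoeffding inequality for independent variables with values in `[0,1]`. -/
theorem measureReal_abs_sum_sub_ge_le {Ω ι : Type*} [MeasurableSpace Ω] {μ : Measure Ω}
    [IsProbabilityMeasure μ] {Y : ι → Ω → ℝ} (hY : iIndepFun Y μ) (hm : ∀ i, Measurable (Y i))
    (h01 : ∀ i ω, Y i ω ∈ Set.Icc (0 : ℝ) 1) (s : Finset ι) {n : ℕ}
    (hn : s.card ≤ n) {t : ℝ} (ht : 0 < t) :
    μ.real {ω | t ≤ |∑ i ∈ s, Y i ω - ∑ i ∈ s, ∫ ω', Y i ω' ∂μ|} ≤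
      2 * Real.exp (-2 * t ^ 2 / n) := by
  -- The exponent is divided by `s.card`, so the empty sum is treated apart; its event is empty
  -- because t > 0.
  rcases s.eq_empty_or_nonempty with rfl | hs
  · have : {ω | t ≤ |∑ i ∈ (∅ : Finset ι), Y i ω - ∑ i ∈ (∅ : Finset ι), ∫ ω', Y i ω' ∂μ|} = ∅ := by
      ext ω
      simp [ht]
    rw [this, measureReal_empty]
    positivity
  have hs0 : (0 : ℝ) < s.card := by exact_mod_cast hs.card_pos
  set Z : ι → Ω → ℝ := fun i ω => Y i ω - ∫ ω', Y i ω' ∂μ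
  have hZ : iIndepFun Z μ :=
    hY.comp (fun i (y : ℝ) => y - ∫ ω', Y i ω' ∂μ) fun i => measurable_id.sub_const _
  have hZ' : iIndepFun (fun i ω => - Z i ω) μ := hZ.comp (fun i (y : ℝ) => -y) fun i => measurable_neg
  -- Hoeffding's lemma with variance proxy 1/4, which produces the exponent -2t²/|s|.
  have hsub : ∀ i, HasSubgaussianMGF (Z i) ((‖(1 : ℝ) - 0‖₊ / 2) ^ 2) μ := fun i =>
    hasSubgaussianMGF_of_mem_Icc (hm i).aemeasurable (ae_of_all _ (h01 i))
  have h1 := HasSubgaussianMGF.measure_sum_ge_le_of_iIndepFun hZ (s := s) (fun i _ => hsub i) ht.le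
  have h2 := HasSubgaussianMGF.measure_sum_ge_le_of_iIndepFun hZ' (s := s)
    (fun i _ => (hsub i).neg) ht.le
  have hexp : -t ^ 2 / (2 * ((∑ _i ∈ s, (‖(1 : ℝ) - 0‖₊ / 2) ^ 2 : NNReal) : ℝ)) =
      -2 * t ^ 2 / s.card := by
    simp
    field_simp
  rw [hexp] at h1 h2
  have hsubset : {ω | t ≤ |∑ i ∈ s, Y i ω - ∑ i ∈ s, ∫ ω', Y i ω' ∂μ|} ⊆
      {ω | t ≤ ∑ i ∈ s, Z i ω} ∪ {ω | t ≤ ∑ i ∈ s, - Z i ω} := by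
    intro ω hω
    simp only [Set.mem_ofPred_eq, le_abs, ← Finset.sum_sub_distrib] at hω
    simpa [Z, Finset.sum_neg_distrib] using hω
  calc _ ≤ _ := measureReal_mono hsubset
    _ ≤ _ := measureReal_union_le _ _
    _ ≤ 2 * Real.exp (-2 * t ^ 2 / s.card) := by linarith
    _ ≤ _ := by
      gcongr 2 * Real.exp ?_
      rw [neg_mul, neg_div, neg_div]
      gcongr

/-- The Bernoulli measure with success probability `w`. -/
def bernoulliBool (w : ℝ) : Measure Bool :=
  ENNReal.ofReal w • Measure.dirac true + ENNReal.ofReal (1 - w) • Measure.dirac false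

theorem isProbabilityMeasure_bernoulliBool {w : ℝ} (h0 : 0 ≤ w) (h1 : w ≤ 1) :
    IsProbabilityMeasure (bernoulliBool w) := by
  refine ⟨?_⟩
  simp [bernoulliBool]
  rw [← ENNReal.ofReal_add h0 (by linarith)]
  simp

theorem integral_bernoulliBool {w : ℝ} (h0 : 0 ≤ w) :
    ∫ b, (if b then (1 : ℝ) else 0) ∂(bernoulliBool w) = w := by
  unfold bernoulliBool
  rw [integral_add_measure, integral_smul_measure, integral_smul_measure, integral_dirac,
    integral_dirac]
  · simp [h0]
  · exact (integrable_dirac (by simp)).smul_measure (by simp)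
  · exact (integrable_dirac (by simp)).smul_measure (by simp)

/-- The graph whose edges are the pairs `i < j` selected by `e`. -/
def graphOfPairs {N : ℕ} (e : Fin N × Fin N → Bool) : SimpleGraph (Fin N) where
  Adj i j := i ≠ j ∧ e (min i j, max i j) = true
  symm := ⟨fun i j h => ⟨h.1.symm, by rw [min_comm, max_comm]; exact h.2⟩⟩
  loopless := ⟨fun i h => h.1 rfl⟩

/-- The event is a cylinder: the coordinates with i < j are prescribed, while diagonal and reversed
pairs are never read and contribute factors 1. -/
theorem pi_bernoulliBool_graphOfPairs_eq {W : unitInterval → unitInterval → ℝ} (hW : IsGraphon W)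
    {N : ℕ} (x : Fin N → unitInterval) (H : SimpleGraph (Fin N)) :
    Measure.pi (fun p : Fin N × Fin N => bernoulliBool (weightedAdj W x p.1 p.2))
      {e | graphOfPairs e = H} = ENNReal.ofReal (graphProb W x H) := by
  classical
  have : ∀ p : Fin N × Fin N, IsProbabilityMeasure (bernoulliBool (weightedAdj W x p.1 p.2)) :=
    fun p => isProbabilityMeasure_bernoulliBool (hW.nonneg _ _) (hW.le_one _ _)
  have hset : {e | graphOfPairs e = H} = Set.univ.pi fun p : Fin N × Fin N =>
      if p.1 < p.2 then {decide (H.Adj p.1 p.2)} else Set.univ := by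
    ext e
    simp only [Set.mem_ofPred_eq, Set.mem_pi, Set.mem_univ, true_imp_iff]
    constructor
    · rintro rfl ⟨i, j⟩
      split_ifs with hij
      · simp only at hij
        simp [graphOfPairs, hij.ne, min_eq_left hij.le, max_eq_right hij.le]
      · trivial
    · intro h
      ext i j
      simp only [graphOfPairs]
      rcases lt_trichotomy i j with hij | rfl | hij
      · have := h (i, j)
        simp only [hij, if_true, Set.mem_singleton_iff] at this
        simp [hij.ne, min_eq_left hij.le, max_eq_right hij.le, this]
      · simp
      · have := h (j, i)
        simp only [hij, if_true, Set.mem_singleton_iff] at this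
        simp [hij.ne', min_eq_right hij.le, max_eq_left hij.le, this, H.adj_comm]
  rw [hset, Measure.pi_pi, graphProb, ENNReal.ofReal_prod_of_nonneg, Finset.prod_filter]
  · refine Finset.prod_congr rfl fun p _ => ?_
    split_ifs with hp hH
    · simp [bernoulliBool, hH]
    · simp [bernoulliBool, hH]
    · exact (this p).measure_univ
  · intro p _
    split_ifs
    · exact hW.nonneg _ _
    · exact sub_nonneg.2 (hW.le_one _ _)

open Classical in
theorem degree_graphOfPairs {N : ℕ} (e : Fin N × Fin N → Bool) (i : Fin N) :
    ((graphOfPairs e).degree i : ℝ) =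
      ∑ j ∈ Finset.univ.erase i, if e (min i j, max i j) then 1 else 0 := by
  rw [SimpleGraph.degree, SimpleGraph.neighborFinset_eq_filter, Finset.card_filter]
  push_cast
  rw [← Finset.add_sum_erase _ _ (Finset.mem_univ i)]
  simp only [graphOfPairs, ne_eq, not_true, false_and, if_false, zero_add]
  refine Finset.sum_congr rfl fun j hj => ?_
  simp [Ne.symm (Finset.ne_of_mem_erase hj)]

theorem injective_min_max {N : ℕ} (i : Fin N) :
    Function.Injective fun j : Fin N => (min i j, max i j) := by
  intro j k h
  simp only [Prod.mk.injEq] at h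
  have h1 := h.1
  have h2 := h.2
  rcases le_total i j with a | a <;> rcases le_total i k with b | b <;>
    simp_all

open Classical in
/-- Concentration of a degree of a random graph with independent edges. -/
theorem pi_bernoulliBool_degree_ge_le {W : unitInterval → unitInterval → ℝ} (hW : IsGraphon W)
    {N : ℕ} (x : Fin N → unitInterval) (i : Fin N) {t : ℝ} (ht : 0 < t) :
    (Measure.pi (fun p : Fin N × Fin N => bernoulliBool (weightedAdj W x p.1 p.2))).real
      {e | t ≤ |((graphOfPairs e).degree i : ℝ) - ∑ j ∈ Finset.univ.erase i, weightedAdj W x i j|} ≤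
      2 * Real.exp (-2 * t ^ 2 / N) := by
  have : ∀ p : Fin N × Fin N, IsProbabilityMeasure (bernoulliBool (weightedAdj W x p.1 p.2)) :=
    fun p => isProbabilityMeasure_bernoulliBool (hW.nonneg _ _) (hW.le_one _ _)
  set μ := Measure.pi (fun p : Fin N × Fin N => bernoulliBool (weightedAdj W x p.1 p.2))
  let f : Bool → ℝ := fun b => if b then 1 else 0
  have hf : Measurable f := measurable_of_countable f
  -- Distinct neighbours of i read distinct coordinates of e, so the indicators in the degree of i
  -- are independent.
  have hind : iIndepFun (fun (j : Fin N) (e : Fin N × Fin N → Bool) => f (e (min i j, max i j))) μ :=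
    (iIndepFun_pi (μ := fun p : Fin N × Fin N => bernoulliBool (weightedAdj W x p.1 p.2))
      (X := fun _ => f) fun _ => hf.aemeasurable).precomp (injective_min_max i)
  have h := measureReal_abs_sum_sub_ge_le hind
    (fun j => hf.comp (measurable_pi_apply _))
    (fun j e => by simp only [f]; split_ifs <;> simp) (Finset.univ.erase i) (n := N)
    ((Finset.card_erase_le).trans (by simp)) ht
  have hint : ∀ j, ∫ e, f (e (min i j, max i j)) ∂μ = weightedAdj W x i j := by
    intro j
    have h1 := integral_comp_eval (μ := fun p : Fin N × Fin N =>
      bernoulliBool (weightedAdj W x p.1 p.2)) (i := (min i j, max i j)) (f := f)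
      hf.aestronglyMeasurable
    refine h1.trans ((integral_bernoulliBool (hW.nonneg _ _)).trans ?_)
    rcases le_total i j with a | a
    · simp [a, weightedAdj]
    · simp [a, weightedAdj, hW.symm]
  simp only [hint] at h
  simpa only [degree_graphOfPairs] using h

/-! ### From independent edges to the sampled graph -/

/-- The sorting permutation takes finitely many values, and each of its fibres is cut out by
comparisons between coordinates, ties included. -/
theorem measurable_orderStat {N : ℕ} (i : Fin N) :
    Measurable fun x : Fin N → unitInterval => orderStat x i := by
  let _ : MeasurableSpace (Equiv.Perm (Fin N)) := ⊤
  have hsort : Measurable fun x : Fin N → unitInterval => Tuple.sort x := by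
    refine measurable_to_countable' fun σ => ?_
    have : (fun x : Fin N → unitInterval => Tuple.sort x) ⁻¹' {σ} =
        ⋂ (i : Fin N) (j : Fin N), {x | (i ≤ j → x (σ i) ≤ x (σ j)) ∧
          (i < j → x (σ i) = x (σ j) → σ i < σ j)} := by
      ext x
      simp only [Set.mem_preimage, Set.mem_singleton_iff, eq_comm (b := σ), Tuple.eq_sort_iff,
        Set.mem_iInter, Set.mem_ofPred_eq, forall_and]
      rfl
    rw [this]
    refine MeasurableSet.iInter fun i => MeasurableSet.iInter fun j => ?_
    have hσ := fun k => measurable_pi_apply (X := fun _ : Fin N => unitInterval) (σ k)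
    exact ((measurable_const.imp (measurableSet_setOfPred.1 (measurableSet_le (hσ i) (hσ j)))).and
      (measurable_const.imp ((measurableSet_setOfPred.1 (measurableSet_eq_fun (hσ i) (hσ j))).imp
        measurable_const))).setOf
  have huncurry : Measurable fun p : (Fin N → unitInterval) × Equiv.Perm (Fin N) => p.1 (p.2 i) :=
    measurable_from_prod_countable_left fun σ => measurable_pi_apply (σ i)
  exact huncurry.comp (measurable_id.prodMk hsort)

theorem measurable_weightedAdj {W : unitInterval → unitInterval → ℝ} (hW : IsGraphon W) {N : ℕ}
    (i j : Fin N) : Measurable fun x : Fin N → unitInterval => weightedAdj W x i j :=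
  hW.measurable.comp ((measurable_orderStat i).prodMk (measurable_orderStat j))

/-- Superadditivity of the lower integral needs no measurability of the summands, so none has to be
checked for x ↦ `graphProb W x H`. -/
theorem sum_lintegral_le_lintegral_sum {α ι : Type*} [MeasurableSpace α] (μ : Measure α)
    (s : Finset ι) (f : ι → α → ENNReal) :
    ∑ i ∈ s, ∫⁻ a, f i a ∂μ ≤ ∫⁻ a, ∑ i ∈ s, f i a ∂μ := by
  classical
  induction s using Finset.induction_on with
  | empty => simp
  | insert i s hi ih =>
    simp only [Finset.sum_insert hi]
    exact (add_le_add_right ih _).trans (le_lintegral_add _ _)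

/-- A bound for graphs with independent edges, uniform in the latent points, carries over to a
sampled graph. -/
theorem measure_latent_mem_le {Ω : Type*} [MeasurableSpace Ω] {P : Measure Ω}
    [IsProbabilityMeasure P] {W : unitInterval → unitInterval → ℝ} (hW : IsGraphon W) {N : ℕ}
    {X : Fin N → Ω → unitInterval} {G : Ω → SimpleGraph (Fin N)} (hG : IsSampledGraph P W X G)
    {B : SimpleGraph (Fin N) → Set (Fin N → unitInterval)} (hB : ∀ H, MeasurableSet (B H))
    {c : ENNReal}
    (hc : ∀ x, Measure.pi (fun p : Fin N × Fin N => bernoulliBool (weightedAdj W x p.1 p.2))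
      {e | x ∈ B (graphOfPairs e)} ≤ c) :
    P {ω | (fun i => X i ω) ∈ B (G ω)} ≤ c := by
  classical
  have hX : Measurable fun ω i => X i ω := measurable_pi_lambda _ hG.measurable_latent
  have hsub : {ω | (fun i => X i ω) ∈ B (G ω)} ⊆
      ⋃ H ∈ (Finset.univ : Finset (SimpleGraph (Fin N))),
        ({ω | (fun i => X i ω) ∈ B H} ∩ {ω | G ω = H}) := by
    intro ω hω
    simp only [Set.mem_iUnion]
    exact ⟨G ω, Finset.mem_univ _, hω, rfl⟩
  calc P {ω | (fun i => X i ω) ∈ B (G ω)}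
      ≤ ∑ H : SimpleGraph (Fin N), P ({ω | (fun i => X i ω) ∈ B H} ∩ {ω | G ω = H}) :=
        (measure_mono hsub).trans (measure_biUnion_finset_le _ _)
    _ = ∑ H : SimpleGraph (Fin N), ∫⁻ ω, {ω | (fun i => X i ω) ∈ B H}.indicator
          (fun ω => ENNReal.ofReal (graphProb W (fun i => X i ω) H)) ω ∂P := by
        refine Finset.sum_congr rfl fun H _ => ?_
        rw [hG.cond_law H (B H) (hB H)]
        exact (lintegral_indicator (hX (hB H)) _).symm
    _ ≤ ∫⁻ ω, ∑ H : SimpleGraph (Fin N), {ω | (fun i => X i ω) ∈ B H}.indicator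
          (fun ω => ENNReal.ofReal (graphProb W (fun i => X i ω) H)) ω ∂P :=
        sum_lintegral_le_lintegral_sum _ _ _
    _ ≤ ∫⁻ _, c ∂P := by
        refine lintegral_mono fun ω => ?_
        set x := fun i => X i ω with hx
        refine le_trans (le_of_eq ?_) (hc x)
        -- For frozen latent points, the sum of graph probabilities over bad graphs is the product
        -- measure of the bad event.
        have hdec : {e | x ∈ B (graphOfPairs e)} =
            ⋃ H ∈ Finset.univ.filter (fun H => x ∈ B H), {e | graphOfPairs e = H} := by
          ext e
          simp
        rw [hdec, measure_biUnion_finset, Finset.sum_filter]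
        · refine Finset.sum_congr rfl fun H _ => ?_
          rw [pi_bernoulliBool_graphOfPairs_eq hW]
          simp only [Set.indicator, Set.mem_ofPred_eq, ← hx]
        · intro H _ H' _ hne
          refine Set.disjoint_left.2 fun e he he' => hne ?_
          exact he.symm.trans he'
        · exact fun H _ => Set.Finite.measurableSet (Set.toFinite _)
    _ = c := by simp

open Classical in
theorem measureReal_degree_deviation_le {Ω : Type*} [MeasurableSpace Ω] {P : Measure Ω}
    [IsProbabilityMeasure P] {W : unitInterval → unitInterval → ℝ} (hW : IsGraphon W) {N : ℕ}
    {X : Fin N → Ω → unitInterval} {G : Ω → SimpleGraph (Fin N)} (hG : IsSampledGraph P W X G)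
    {t : ℝ} (ht : 0 < t) :
    P.real {ω | ∃ i, t ≤ |((G ω).degree i : ℝ) -
      ∑ j ∈ Finset.univ.erase i, weightedAdj W (fun k => X k ω) i j|} ≤
      N * (2 * Real.exp (-2 * t ^ 2 / N)) := by
  have h := measure_latent_mem_le hW hG (B := fun H => ⋃ i, {x | t ≤ |(H.degree i : ℝ) -
    ∑ j ∈ Finset.univ.erase i, weightedAdj W x i j|})
    (c := ENNReal.ofReal (N * (2 * Real.exp (-2 * t ^ 2 / N)))) (fun H => ?_) (fun x => ?_)
  · refine ENNReal.toReal_le_of_le_ofReal (by positivity) ?_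
    simpa [Set.mem_iUnion] using h
  · refine MeasurableSet.iUnion fun i => measurableSet_le measurable_const ?_
    have := fun j => measurable_weightedAdj hW i j
    fun_prop
  · have : ∀ p : Fin N × Fin N, IsProbabilityMeasure (bernoulliBool (weightedAdj W x p.1 p.2)) :=
      fun p => isProbabilityMeasure_bernoulliBool (hW.nonneg _ _) (hW.le_one _ _)
    rw [ENNReal.le_ofReal_iff_toReal_le (measure_ne_top _ _) (by positivity)]
    have hset : {e : Fin N × Fin N → Bool | x ∈ ⋃ i, {x | t ≤ |((graphOfPairs e).degree i : ℝ) -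
        ∑ j ∈ Finset.univ.erase i, weightedAdj W x i j|}} =
        ⋃ i, {e | t ≤ |((graphOfPairs e).degree i : ℝ) -
          ∑ j ∈ Finset.univ.erase i, weightedAdj W x i j|} := by
      ext e
      simp
    rw [hset]
    refine (measureReal_iUnion_fintype_le _).trans ?_
    refine (Finset.sum_le_sum fun i _ => pi_bernoulliBool_degree_ge_le hW x i ht).trans ?_
    simp

/-! ### The degree function and averages over the sample -/

theorem IsGraphon.measurable_right {W : unitInterval → unitInterval → ℝ} (hW : IsGraphon W)
    (x : unitInterval) : Measurable (W x) :=
  hW.measurable.comp measurable_prodMk_left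

theorem IsGraphon.integrable {W : unitInterval → unitInterval → ℝ} (hW : IsGraphon W)
    (x : unitInterval) : Integrable (W x) :=
  Integrable.of_bound (hW.measurable_right x).aestronglyMeasurable 1 <| ae_of_all _ fun y => by
    rw [Real.norm_eq_abs, abs_of_nonneg (hW.nonneg x y)]
    exact hW.le_one x y

theorem IsGraphon.measurable_degreeFn {W : unitInterval → unitInterval → ℝ} (hW : IsGraphon W) :
    Measurable (degreeFn W) :=
  (hW.measurable.stronglyMeasurable.integral_prod_right' (ν := volume)).measurable

theorem IsGraphon.degreeFn_nonneg {W : unitInterval → unitInterval → ℝ} (hW : IsGraphon W)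
    (x : unitInterval) : 0 ≤ degreeFn W x :=
  integral_nonneg fun y => hW.nonneg x y

theorem IsGraphon.degreeFn_le_one {W : unitInterval → unitInterval → ℝ} (hW : IsGraphon W)
    (x : unitInterval) : degreeFn W x ≤ 1 := by
  have := integral_mono (hW.integrable x) (integrable_const (1 : ℝ)) fun y => hW.le_one x y
  simpa [degreeFn] using this

theorem IsGraphon.monotone_degreeFn {W : unitInterval → unitInterval → ℝ} (hW : IsGraphon W)
    (hmono : ∀ y, Monotone fun x => W x y) : Monotone (degreeFn W) := fun x₁ x₂ h =>
  integral_mono (hW.integrable x₁) (hW.integrable x₂) fun y => hmono y h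

/-- The average of `W(X_j, ·)` over the other sample points concentrates around `d(X_j)`. -/
theorem measureReal_sum_sub_degreeFn_ge_le {Ω : Type*} [MeasurableSpace Ω] {P : Measure Ω}
    [IsProbabilityMeasure P] {W : unitInterval → unitInterval → ℝ} (hW : IsGraphon W) {N : ℕ}
    {X : Fin N → Ω → unitInterval} {G : Ω → SimpleGraph (Fin N)} (hG : IsSampledGraph P W X G)
    (j : Fin N) {t : ℝ} (ht : 0 < t) :
    P.real {ω | t ≤ |∑ k ∈ Finset.univ.erase j, W (X j ω) (X k ω) -
      ((N : ℝ) - 1) * degreeFn W (X j ω)|} ≤ 2 * Real.exp (-2 * t ^ 2 / N) := by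
  obtain _ | n := N
  · exact j.elim0
  have hlaw : P.map (fun ω i => X i ω) = Measure.pi fun _ => (volume : Measure unitInterval) := by
    rw [(iIndepFun_iff_map_fun_eq_pi_map fun i => (hG.measurable_latent i).aemeasurable).1 hG.indep]
    simp only [hG.uniform]
  -- Coordinate j is split off, so that Fubini reduces the bound to slices with X_j frozen.
  let T : Set (unitInterval × (Fin n → unitInterval)) :=
    {p | t ≤ |∑ k, W p.1 (p.2 k) - n * degreeFn W p.1|}
  have hT : MeasurableSet T := by
    have h1 := hW.measurable_degreeFn
    have h2 : ∀ k, Measurable fun p : unitInterval × (Fin n → unitInterval) => W p.1 (p.2 k) :=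
      fun k => hW.measurable.comp (measurable_fst.prodMk ((measurable_pi_apply k).comp measurable_snd))
    exact measurableSet_le measurable_const (continuous_abs.measurable.comp
      ((Finset.univ.measurable_fun_sum fun k _ => h2 k).sub
        ((h1.comp measurable_fst).const_mul _)))
  have hX : Measurable fun ω i => X i ω := measurable_pi_lambda _ hG.measurable_latent
  have hmp := measurePreserving_piFinSuccAbove (fun _ : Fin (n + 1) => (volume : Measure unitInterval)) j
  have hset : {ω | t ≤ |∑ k ∈ Finset.univ.erase j, W (X j ω) (X k ω) -
      (((n + 1 : ℕ) : ℝ) - 1) * degreeFn W (X j ω)|} = (fun ω i => X i ω) ⁻¹'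
        (MeasurableEquiv.piFinSuccAbove (fun _ => unitInterval) j ⁻¹' T) := by
    ext ω
    have hsum : ∑ k ∈ Finset.univ.erase j, W (X j ω) (X k ω) =
        ∑ k, W (X j ω) (X (j.succAbove k) ω) := by
      have h1 := Fin.sum_univ_succAbove (fun k => W (X j ω) (X k ω)) j
      rw [← Finset.add_sum_erase _ _ (Finset.mem_univ j)] at h1
      exact add_left_cancel h1
    simp only [Set.mem_ofPred_eq, hsum, Set.mem_preimage, T]
    push_cast
    rw [add_sub_cancel_right]
    rfl
  -- The other n = N - 1 points are i.i.d. uniform and W x has mean d(x); Hoeffding is applied with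
  -- the weaker count n + 1 = N.
  have hslice : ∀ x, (Measure.pi fun _ : Fin n => (volume : Measure unitInterval)) (Prod.mk x ⁻¹' T) ≤
      ENNReal.ofReal (2 * Real.exp (-2 * t ^ 2 / (n + 1 : ℕ))) := by
    intro x
    rw [ENNReal.le_ofReal_iff_toReal_le (measure_ne_top _ _) (by positivity)]
    have hWx := hW.measurable_right x
    have h := measureReal_abs_sum_sub_ge_le
      (iIndepFun_pi (μ := fun _ : Fin n => (volume : Measure unitInterval)) (X := fun _ => W x)
        fun _ => hWx.aemeasurable)
      (fun k => hWx.comp (measurable_pi_apply k))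
      (fun k ω => ⟨hW.nonneg _ _, hW.le_one _ _⟩) Finset.univ (n := n + 1) (by simp) ht
    have hint : ∀ k : Fin n, ∫ y, W x (y k) ∂(Measure.pi fun _ : Fin n =>
        (volume : Measure unitInterval)) = degreeFn W x := fun k =>
      integral_comp_eval (μ := fun _ : Fin n => (volume : Measure unitInterval)) (i := k) (f := W x)
        hWx.aestronglyMeasurable
    simp only [hint, Finset.sum_const, Finset.card_univ, Fintype.card_fin, nsmul_eq_mul] at h
    exact h
  refine ENNReal.toReal_le_of_le_ofReal (by positivity) ?_
  rw [hset, ← Measure.map_apply hX (hmp.measurable hT), hlaw, hmp.measure_preimage hT.nullMeasurableSet,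
    Measure.prod_apply hT]
  calc _ ≤ ∫⁻ _ : unitInterval, ENNReal.ofReal (2 * Real.exp (-2 * t ^ 2 / (n + 1 : ℕ))) :=
        lintegral_mono hslice
    _ = _ := by simp

/-! ### Empirical distribution function and order statistics -/

/-- Concentration of the empirical distribution function at a point. -/
theorem measureReal_card_sub_ge_le {Ω : Type*} [MeasurableSpace Ω] {P : Measure Ω}
    [IsProbabilityMeasure P] {W : unitInterval → unitInterval → ℝ} {N : ℕ}
    {X : Fin N → Ω → unitInterval} {G : Ω → SimpleGraph (Fin N)} (hG : IsSampledGraph P W X G)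
    (c : unitInterval) {t : ℝ} (ht : 0 < t) :
    P.real {ω | t ≤ |((Finset.univ.filter fun j => X j ω ≤ c).card : ℝ) - N * c|} ≤
      2 * Real.exp (-2 * t ^ 2 / N) := by
  let f : unitInterval → ℝ := (Set.Iic c).indicator fun _ => 1
  have hf : Measurable f := measurable_const.indicator measurableSet_Iic
  have h := measureReal_abs_sum_sub_ge_le (hG.indep.comp (fun _ => f) fun _ => hf)
    (fun j => hf.comp (hG.measurable_latent j))
    (fun j ω => by
      simp only [f, Function.comp_apply, Set.indicator]
      split_ifs <;> simp) Finset.univ (n := N) (by simp) ht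
  have hint : ∀ j, ∫ ω, (f ∘ X j) ω ∂P = c := by
    intro j
    have h1 := integral_map (hG.measurable_latent j).aemeasurable (μ := P) (f := f)
      hf.aestronglyMeasurable
    rw [hG.uniform j] at h1
    simp only [Function.comp_apply]
    rw [← h1, integral_indicator measurableSet_Iic]
    simp [Measure.real, c.2.1]
  simp only [hint, Finset.sum_const, Finset.card_univ, Fintype.card_fin, nsmul_eq_mul] at h
  refine le_trans (le_of_eq ?_) h
  congr 1
  ext ω
  simp only [f, Function.comp_apply, Set.indicator, Set.mem_Iic, Finset.sum_boole]

/-- The half-open pieces leave out the point 1, where the Lipschitz condition says nothing; sample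
points equal to 1 must be discarded. -/
theorem ae_latent_lt_one {Ω : Type*} [MeasurableSpace Ω] {P : Measure Ω}
    {W : unitInterval → unitInterval → ℝ} {N : ℕ}
    {X : Fin N → Ω → unitInterval} {G : Ω → SimpleGraph (Fin N)} (hG : IsSampledGraph P W X G) :
    ∀ᵐ ω ∂P, ∀ j, X j ω < 1 := by
  rw [ae_all_iff]
  intro j
  have h : ∀ᵐ x ∂(P.map (X j)), x < 1 := by
    rw [hG.uniform j]
    filter_upwards [Measure.ae_ne volume (1 : unitInterval)] with x hx
    exact lt_of_le_of_ne x.2.2 hx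
  exact ae_of_ae_map (hG.measurable_latent j).aemeasurable h

/-- Order statistics are close to the grid if the empirical distribution function is. -/
theorem orderStat_mem_of_card {N : ℕ} (hN : 0 < N) (x : Fin N → unitInterval) {s : ℝ} (hs : 0 < s)
    (i : Fin N)
    (hlo : |((Finset.univ.filter fun j =>
      x j ≤ Set.projIcc (0 : ℝ) 1 zero_le_one ((i : ℝ) / N - s)).card : ℝ) -
        N * Set.projIcc (0 : ℝ) 1 zero_le_one ((i : ℝ) / N - s)| < N * s)
    (hup : |((Finset.univ.filter fun j =>
      x j ≤ Set.projIcc (0 : ℝ) 1 zero_le_one (((i : ℝ) + 1) / N + s)).card : ℝ) -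
        N * Set.projIcc (0 : ℝ) 1 zero_le_one (((i : ℝ) + 1) / N + s)| < N * s) :
    (i : ℝ) / N - s ≤ orderStat x i ∧ (orderStat x i : ℝ) ≤ ((i : ℝ) + 1) / N + s := by
  have hN' : (0 : ℝ) < N := by exact_mod_cast hN
  -- With indices from 0, the i-th order statistic is at most c exactly when at least i + 1 sample
  -- points are.
  have hcard : ∀ c : unitInterval, (i : ℕ) < (Finset.univ.filter fun j => x j ≤ c).card ↔
      orderStat x i ≤ c := by
    intro c
    have h := Tuple.lt_card_le_iff_apply_le_of_monotone (j := i) (a := c) (Tuple.monotone_sort x)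
    rw [orderStat, ← Function.comp_apply (f := x), ← h]
    have : (Finset.univ.filter fun j => x j ≤ c).card =
        (Finset.univ.filter fun j => (x ∘ Tuple.sort x) j ≤ c).card := by
      simp only [Finset.card_filter]
      exact (Equiv.sum_comp (Tuple.sort x) fun j => if x j ≤ c then 1 else 0).symm
    rw [this]
  have hx0 := (orderStat x i).2.1
  have hx1 := (orderStat x i).2.2
  have hi0 : (0 : ℝ) ≤ (i : ℝ) / N := by positivity
  have hi1 : ((i : ℝ) + 1) / N ≤ 1 := by
    rw [div_le_one hN']
    exact_mod_cast i.2
  have hi2 : (i : ℝ) / N ≤ 1 := hi1.trans' (by gcongr; linarith)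
  -- A violated bound forces its threshold into [0,1], so the clipping by `projIcc` is harmless. The
  -- count at the threshold then misses its mean by at least N s.
  constructor
  · by_contra! hlt
    have hmem : (i : ℝ) / N - s ∈ Set.Icc (0 : ℝ) 1 := ⟨by linarith, by linarith⟩
    rw [Set.projIcc_of_mem _ hmem] at hlo
    have h2 := (hcard ⟨_, hmem⟩).2 hlt.le
    have h3 : (i : ℝ) + 1 ≤ ((Finset.univ.filter fun j =>
      x j ≤ (⟨(i : ℝ) / N - s, hmem⟩ : unitInterval)).card : ℝ) := by exact_mod_cast h2
    have h4 : (N : ℝ) * ((i : ℝ) / N - s) = i - N * s := by field_simp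
    have := (abs_lt.1 hlo).2
    simp only [h4] at this
    linarith
  · by_contra! hlt
    have hmem : ((i : ℝ) + 1) / N + s ∈ Set.Icc (0 : ℝ) 1 := ⟨by positivity, by linarith⟩
    rw [Set.projIcc_of_mem _ hmem] at hup
    have h2 := (hcard ⟨_, hmem⟩).not.2 (not_le.2 hlt)
    have h3 : ((Finset.univ.filter fun j =>
      x j ≤ (⟨((i : ℝ) + 1) / N + s, hmem⟩ : unitInterval)).card : ℝ) ≤ i := by
      exact_mod_cast not_lt.1 h2
    have h4 : (N : ℝ) * (((i : ℝ) + 1) / N + s) = i + 1 + N * s := by field_simp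
    have := (abs_lt.1 hup).1
    simp only [h4] at this
    linarith

/-! ### Regularity of the degree function -/

theorem IsPiecewiseLipschitz.exists_mem_Ico {W : unitInterval → unitInterval → ℝ} {L : ℝ} {K : ℕ}
    {α : Fin (K + 2) → ℝ} (h : IsPiecewiseLipschitz W L K α) {y : unitInterval} (hy : y < 1) :
    ∃ l : Fin (K + 1), (y : ℝ) ∈ Set.Ico (α l.castSucc) (α l.succ) := by
  by_contra! hcon
  have key : ∀ k : Fin (K + 2), α k ≤ y := by
    intro k
    induction k using Fin.induction with
    | zero => rw [h.first]; exact y.2.1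
    | succ l ih =>
      by_contra! hlt
      exact hcon l ⟨ih, hlt⟩
  have := key (Fin.last (K + 1))
  rw [h.last] at this
  exact absurd hy (not_lt.2 this)

/-- Inside the first piece, 0 and the midpoint are at positive distance, and L times that distance
bounds an absolute value. -/
theorem IsPiecewiseLipschitz.nonneg {W : unitInterval → unitInterval → ℝ} {L : ℝ} {K : ℕ}
    {α : Fin (K + 2) → ℝ} (h : IsPiecewiseLipschitz W L K α) : 0 ≤ L := by
  have h0 : α (0 : Fin (K + 1)).castSucc = 0 := h.first
  have h1 : 0 < α (0 : Fin (K + 1)).succ := by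
    rw [← h0]
    exact h.strictMono (Fin.castSucc_lt_succ)
  have h2 : α (0 : Fin (K + 1)).succ ≤ 1 := by
    rw [← h.last]
    exact h.strictMono.monotone (Fin.le_last _)
  have ha : α (0 : Fin (K + 1)).succ / 2 ∈ Set.Icc (0 : ℝ) 1 := ⟨by linarith, by linarith⟩
  have hz : ((0 : unitInterval) : ℝ) ∈
      Set.Ico (α (0 : Fin (K + 1)).castSucc) (α (0 : Fin (K + 1)).succ) := by
    rw [h0]; exact ⟨le_rfl, h1⟩
  have ha' : ((⟨_, ha⟩ : unitInterval) : ℝ) ∈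
      Set.Ico (α (0 : Fin (K + 1)).castSucc) (α (0 : Fin (K + 1)).succ) := by
    rw [h0]; exact ⟨ha.1, by simp only; linarith⟩
  have := (abs_nonneg _).trans (h.lipschitz 0 0 0 ⟨_, ha⟩ 0 0 hz ha' hz hz)
  simp only [Set.Icc.coe_zero, zero_sub, abs_neg, neg_zero, abs_zero, add_zero] at this
  rw [abs_of_pos (by linarith)] at this
  exact nonneg_of_mul_nonneg_left this (by linarith)

/-- The degree function of a piecewise Lipschitz graphon is piecewise Lipschitz. -/
theorem IsPiecewiseLipschitz.abs_degreeFn_sub_le {W : unitInterval → unitInterval → ℝ}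
    (hW : IsGraphon W) {L : ℝ} {K : ℕ}
    {α : Fin (K + 2) → ℝ} (h : IsPiecewiseLipschitz W L K α) {k : Fin (K + 1)}
    {x₁ x₂ : unitInterval} (h₁ : (x₁ : ℝ) ∈ Set.Ico (α k.castSucc) (α k.succ))
    (h₂ : (x₂ : ℝ) ∈ Set.Ico (α k.castSucc) (α k.succ)) :
    |degreeFn W x₁ - degreeFn W x₂| ≤ L * |(x₁ : ℝ) - x₂| := by
  unfold degreeFn
  rw [← integral_sub (hW.integrable x₁) (hW.integrable x₂), ← Real.norm_eq_abs]
  refine (norm_integral_le_of_norm_le_const (C := L * |(x₁ : ℝ) - x₂|) ?_).trans (by simp)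
  filter_upwards [Measure.ae_ne volume (1 : unitInterval)] with y hy
  obtain ⟨l, hl⟩ := h.exists_mem_Ico (lt_of_le_of_ne y.2.2 hy)
  simpa using h.lipschitz k l x₁ x₂ y y h₁ h₂ hl hl

/-- Two points below `1` that are close to each other lie in the same piece, unless both are close
to an interior breakpoint. -/
theorem IsPiecewiseLipschitz.same_piece_or {W : unitInterval → unitInterval → ℝ} {L : ℝ} {K : ℕ}
    {α : Fin (K + 2) → ℝ} (h : IsPiecewiseLipschitz W L K α) {x x' : unitInterval} (hx : x < 1)
    (hx' : x' < 1) {b : ℝ} (hb : |(x' : ℝ) - x| ≤ b) :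
    (∃ k : Fin (K + 1), (x : ℝ) ∈ Set.Ico (α k.castSucc) (α k.succ) ∧
      (x' : ℝ) ∈ Set.Ico (α k.castSucc) (α k.succ)) ∨
    ∃ m : Fin K, |(x : ℝ) - α m.succ.castSucc| ≤ b := by
  obtain ⟨k, hk⟩ := h.exists_mem_Ico hx
  rw [abs_le] at hb
  -- If x' leaves the piece of x, an endpoint of that piece separates the two points. It is an
  -- interior breakpoint because both points lie in [0,1).
  by_cases h1 : α k.castSucc ≤ x'
  · by_cases h2 : (x' : ℝ) < α k.succ
    · exact Or.inl ⟨k, hk, h1, h2⟩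
    · right
      have hne : k ≠ Fin.last K := by
        rintro rfl
        rw [Fin.succ_last, h.last] at h2
        exact h2 hx'
      obtain ⟨m, rfl⟩ := Fin.exists_castSucc_eq.2 hne
      refine ⟨m, ?_⟩
      rw [← Fin.succ_castSucc, abs_le]
      constructor <;> linarith [hk.1, hk.2, hb.1, hb.2]
  · right
    have hne : k ≠ 0 := by
      rintro rfl
      rw [Fin.castSucc_zero, h.first] at h1
      exact h1 x'.2.1
    obtain ⟨m, rfl⟩ := Fin.exists_succ_eq.2 hne
    refine ⟨m, ?_⟩
    rw [abs_le]
    constructor <;> linarith [hk.1, hk.2, hb.1, hb.2]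

/-! ### Blocks, step functions and L² estimates -/

theorem volume_setOf_abs_sub_le (a b : ℝ) :
    volume {x : unitInterval | |(x : ℝ) - a| ≤ b} ≤ ENNReal.ofReal (2 * b) := by
  rw [unitInterval.volume_apply]
  refine (measure_mono (t := Set.Icc (a - b) (a + b)) ?_).trans ?_
  · rintro _ ⟨x, hx, rfl⟩
    have := abs_le.1 (show |(x : ℝ) - a| ≤ b from hx)
    exact ⟨by linarith, by linarith⟩
  · rw [Real.volume_Icc]
    gcongr
    linarith

theorem measurableSet_setOf_abs_sub_le (a b : ℝ) :
    MeasurableSet {x : unitInterval | |(x : ℝ) - a| ≤ b} :=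
  measurableSet_le (by fun_prop) measurable_const

theorem measurableSet_block (N : ℕ) (i : Fin N) : MeasurableSet (block N i) := by
  have h : Measurable fun x : unitInterval => (x : ℝ) := measurable_subtype_coe
  exact (measurableSet_le measurable_const h).inter
    ((measurableSet_lt h measurable_const).union (MeasurableSet.const _))

theorem mem_Icc_of_mem_block {N : ℕ} {i : Fin N} {x : unitInterval} (hx : x ∈ block N i) :
    (x : ℝ) ∈ Set.Icc ((i : ℝ) / N) (((i : ℝ) + 1) / N) := by
  refine ⟨hx.1, ?_⟩
  rcases hx.2 with h | h
  · exact h.le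
  · have h0 : (0 : ℝ) < N := by exact_mod_cast i.pos
    have h1 : (i : ℝ) + 1 = N := by exact_mod_cast h
    rw [h1, div_self h0.ne']
    exact x.2.2

theorem volume_block_le (N : ℕ) (i : Fin N) : volume (block N i) ≤ ENNReal.ofReal (1 / N) := by
  rw [unitInterval.volume_apply]
  refine (measure_mono (t := Set.Icc ((i : ℝ) / N) (((i : ℝ) + 1) / N)) ?_).trans ?_
  · rintro _ ⟨x, hx, rfl⟩
    exact mem_Icc_of_mem_block hx
  · rw [Real.volume_Icc]
    gcongr
    rw [← sub_div]
    simp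

theorem exists_mem_block {N : ℕ} (hN : 0 < N) (x : unitInterval) : ∃ i, x ∈ block N i := by
  have hN' : (0 : ℝ) < N := by exact_mod_cast hN
  rcases eq_or_lt_of_le (show (x : ℝ) ≤ 1 from x.2.2) with h | h
  · refine ⟨⟨N - 1, by omega⟩, ?_, Or.inr (by simp only; omega)⟩
    rw [h, div_le_one hN']
    simp
  · have h0 : 0 ≤ N * (x : ℝ) := mul_nonneg hN'.le x.2.1
    refine ⟨⟨⌊N * (x : ℝ)⌋₊, (Nat.floor_lt h0).2 (by nlinarith)⟩, ?_, Or.inl ?_⟩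
    · rw [div_le_iff₀ hN']
      exact (Nat.floor_le h0).trans_eq (mul_comm _ _)
    · rw [lt_div_iff₀ hN', mul_comm]
      exact Nat.lt_floor_add_one _

theorem eq_of_mem_block {N : ℕ} {i j : Fin N} {x : unitInterval} (hi : x ∈ block N i)
    (hj : x ∈ block N j) : i = j := by
  have key : ∀ i j : Fin N, x ∈ block N i → x ∈ block N j → ¬ i < j := by
    intro i j hi hj hij
    have h0 : (0 : ℝ) < N := by exact_mod_cast i.pos
    rcases hi.2 with h | h
    · have h1 := hj.1.trans_lt h
      rw [div_lt_div_iff_of_pos_right h0] at h1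
      have h2 : (j : ℕ) < i + 1 := by exact_mod_cast h1
      have h3 : (i : ℕ) < j := hij
      omega
    · have h3 : (i : ℕ) < j := hij
      have := j.2
      omega
  exact le_antisymm (not_lt.1 (key j i hj hi)) (not_lt.1 (key i j hi hj))

/-- The step function with values `c i` on the blocks of the uniform partition. -/
def stepFn {N : ℕ} (c : Fin N → ℝ) (x : unitInterval) : ℝ :=
  ∑ i : Fin N, (block N i).indicator (fun _ => c i) x

theorem stepFn_eq {N : ℕ} (c : Fin N → ℝ) {x : unitInterval} {i : Fin N} (hx : x ∈ block N i) :
    stepFn c x = c i := by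
  unfold stepFn
  rw [Finset.sum_eq_single i]
  · simp [hx]
  · intro j _ hj
    exact Set.indicator_of_notMem (fun h => hj (eq_of_mem_block h hx)) _
  · simp

theorem measurable_stepFn {N : ℕ} (c : Fin N → ℝ) : Measurable (stepFn c) :=
  Finset.univ.measurable_fun_sum fun i _ => measurable_const.indicator (measurableSet_block N i)

theorem eLpNorm_two_le_ofReal {f : unitInterval → ℝ} {r : ℝ} (hr : 0 ≤ r)
    (h : ∫⁻ x, ENNReal.ofReal (f x ^ 2) ≤ ENNReal.ofReal (r ^ 2)) :
    eLpNorm f 2 volume ≤ ENNReal.ofReal r := by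
  rw [eLpNorm_eq_lintegral_rpow_enorm_toReal (by norm_num) (by norm_num)]
  have h1 : ∀ x, ‖f x‖ₑ ^ (2 : ENNReal).toReal = ENNReal.ofReal (f x ^ 2) := by
    intro x
    rw [Real.enorm_eq_ofReal_abs, ENNReal.toReal_ofNat, ENNReal.ofReal_rpow_of_nonneg (abs_nonneg _)
      (by norm_num)]
    simp
  simp only [h1]
  refine (ENNReal.rpow_le_rpow h (by norm_num)).trans (le_of_eq ?_)
  rw [ENNReal.ofReal_rpow_of_nonneg (sq_nonneg r) (by norm_num), ENNReal.toReal_ofNat,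
    ← Real.sqrt_eq_rpow, Real.sqrt_sq hr]

theorem eLpNorm_stepFn_le {N : ℕ} (c : Fin N → ℝ) {r : ℝ} (hr : 0 ≤ r)
    (h : ∑ i, c i ^ 2 ≤ N * r ^ 2) : eLpNorm (stepFn c) 2 volume ≤ ENNReal.ofReal r := by
  refine eLpNorm_two_le_ofReal hr ?_
  rcases Nat.eq_zero_or_pos N with rfl | hN
  · simp [stepFn]
  have hN' : (0 : ℝ) < N := by exact_mod_cast hN
  have hsq : ∀ x, ENNReal.ofReal (stepFn c x ^ 2) =
      ∑ i, (block N i).indicator (fun _ => ENNReal.ofReal (c i ^ 2)) x := by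
    intro x
    obtain ⟨i, hi⟩ := exists_mem_block hN x
    rw [stepFn_eq c hi, Finset.sum_eq_single i]
    · simp [hi]
    · intro j _ hj
      exact Set.indicator_of_notMem (fun h => hj (eq_of_mem_block h hi)) _
    · simp
  simp only [hsq]
  rw [lintegral_finsetSum _ fun i _ => measurable_const.indicator (measurableSet_block N i)]
  calc ∑ i, ∫⁻ x, (block N i).indicator (fun _ => ENNReal.ofReal (c i ^ 2)) x
      ≤ ∑ i, ENNReal.ofReal (c i ^ 2 * (1 / N)) := by
        refine Finset.sum_le_sum fun i _ => ?_
        rw [lintegral_indicator_const (measurableSet_block N i), ENNReal.ofReal_mul (sq_nonneg _)]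
        gcongr
        exact volume_block_le N i
    _ = ENNReal.ofReal (∑ i, c i ^ 2 * (1 / N)) :=
        (ENNReal.ofReal_sum_of_nonneg fun i _ => by positivity).symm
    _ ≤ ENNReal.ofReal (r ^ 2) := by
        gcongr
        rw [← Finset.sum_mul, mul_one_div, div_le_iff₀ hN']
        linarith

/-- The sampled degree function is close to the degree function if the sample is close to the
grid. -/
theorem lintegral_sq_stepFn_degreeFn_sub_le {W : unitInterval → unitInterval → ℝ}
    (hW : IsGraphon W) {L : ℝ} {K : ℕ} {α : Fin (K + 2) → ℝ} (h : IsPiecewiseLipschitz W L K α)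
    {N : ℕ} (hN : 0 < N) {ξ : Fin N → unitInterval} (hξ1 : ∀ i, ξ i < 1) {b : ℝ} (hb : 0 ≤ b)
    (hξ : ∀ i, ∀ x ∈ block N i, |(ξ i : ℝ) - x| ≤ b) :
    ∫⁻ x, ENNReal.ofReal ((stepFn (fun i => degreeFn W (ξ i)) x - degreeFn W x) ^ 2) ≤
      ENNReal.ofReal (min 1 (L ^ 2 * b ^ 2 + 2 * K * b)) := by
  have hle1 : ∀ x y, (degreeFn W x - degreeFn W y) ^ 2 ≤ 1 := by
    intro x y
    have h1 := hW.degreeFn_nonneg x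
    have h2 := hW.degreeFn_nonneg y
    have h3 := hW.degreeFn_le_one x
    have h4 := hW.degreeFn_le_one y
    rw [sq_le_one_iff_abs_le_one, abs_le]
    constructor <;> linarith
  rw [ENNReal.ofReal_min]
  refine le_min ?_ ?_
  · calc _ ≤ ∫⁻ _ : unitInterval, ENNReal.ofReal 1 := by
          refine lintegral_mono fun x => ENNReal.ofReal_le_ofReal ?_
          obtain ⟨i, hi⟩ := exists_mem_block hN x
          rw [stepFn_eq _ hi]
          exact hle1 _ _
      _ = _ := by simp
  · let S : Fin K → Set unitInterval := fun m => {x | |(x : ℝ) - α m.succ.castSucc| ≤ b}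
    have hS : ∀ m, MeasurableSet (S m) := fun m => measurableSet_setOf_abs_sub_le _ _
    calc _ ≤ ∫⁻ x, (ENNReal.ofReal (L ^ 2 * b ^ 2) + ∑ m, (S m).indicator (fun _ => 1) x) := by
          refine lintegral_mono_ae ?_
          filter_upwards [Measure.ae_ne volume (1 : unitInterval)] with x hx
          obtain ⟨i, hi⟩ := exists_mem_block hN x
          rw [stepFn_eq _ hi]
          -- Either the Lipschitz bound gives L²b², or x is within b of one of the K interior
          -- breakpoints and the trivial bound 1 is used there.
          rcases h.same_piece_or (lt_of_le_of_ne x.2.2 hx) (hξ1 i) (hξ i x hi) with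
            ⟨k, hk, hk'⟩ | ⟨m, hm⟩
          · refine le_add_right (ENNReal.ofReal_le_ofReal ?_)
            have h1 := (h.abs_degreeFn_sub_le hW hk' hk).trans
              (mul_le_mul_of_nonneg_left (hξ i x hi) h.nonneg)
            rw [← mul_pow, ← sq_abs]
            gcongr
          · refine le_add_left ?_
            refine le_trans ?_ (Finset.single_le_sum (fun _ _ => zero_le) (Finset.mem_univ m))
            rw [Set.indicator_of_mem (show x ∈ S m from hm), ← ENNReal.ofReal_one]
            exact ENNReal.ofReal_le_ofReal (hle1 _ _)
      _ ≤ ENNReal.ofReal (L ^ 2 * b ^ 2) + ∑ _m : Fin K, ENNReal.ofReal (2 * b) := by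
          rw [lintegral_add_left measurable_const,
            lintegral_finsetSum _ fun m _ => measurable_const.indicator (hS m)]
          simp only [lintegral_const, measure_univ, mul_one]
          gcongr with m
          rw [lintegral_indicator_const (hS m), one_mul]
          exact volume_setOf_abs_sub_le _ _
      _ = _ := by
          rw [ENNReal.ofReal_add (by positivity) (by positivity), Finset.sum_const,
            Finset.card_univ, Fintype.card_fin, nsmul_eq_mul,
            show 2 * (K : ℝ) * b = K * (2 * b) by ring, ENNReal.ofReal_mul (p := (K : ℝ)) (by positivity),
            ENNReal.ofReal_natCast]

/-! ### Comparison with φ(N) and ϑ(N) -/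

theorem infW_le_one {W : unitInterval → unitInterval → ℝ} (hW : IsGraphon W) : infW W ≤ 1 := by
  refine (csInf_le ?_ (Set.mem_range_self ((0, 0) : unitInterval × unitInterval))).trans
    (hW.le_one 0 0)
  refine ⟨0, ?_⟩
  rintro _ ⟨p, rfl⟩
  exact hW.nonneg _ _

/-- Since η ≤ 1, the factor 1/√η + 2 is at least 3. -/
theorem sq_phiN_ge {η : ℝ} (hη0 : 0 < η) (hη1 : η ≤ 1) {ν : ℝ} {N : ℕ}
    (hlog : 0 ≤ Real.log (2 * N / ν)) :
    9 * (Real.log (2 * N / ν) / N) ≤ phiN η ν N ^ 2 := by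
  have h1 : 1 ≤ 1 / Real.sqrt η := by
    rw [le_div_iff₀ (Real.sqrt_pos.2 hη0), one_mul]
    exact Real.sqrt_le_one.2 hη1
  rw [phiN, mul_pow, Real.sq_sqrt (by positivity)]
  gcongr
  nlinarith

/-- If 2Kb ≤ 1, then K²b² ≤ Kb/2, so ϑ² ≥ 4L²b² + 2Kb. Otherwise K ≤ L and Kb > 1/2, so ϑ² ≥ 4Kb
exceeds the trivial bound 1. -/
theorem min_le_sq_thetaN {L : ℝ} {K : ℕ} {ν : ℝ} {N : ℕ} (hb0 : 0 ≤ bN ν N)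
    (hb : 2 * (K : ℝ) * bN ν N ≤ 1 ∨ (K : ℝ) ≤ L) :
    min 1 (L ^ 2 * bN ν N ^ 2 + 2 * K * bN ν N) ≤ thetaN L K ν N ^ 2 := by
  set b := bN ν N
  have hK : (0 : ℝ) ≤ K := K.cast_nonneg
  have hKb : 0 ≤ K * b := mul_nonneg hK hb0
  by_cases h : 2 * (K : ℝ) * b ≤ 1
  · refine (min_le_right _ _).trans ?_
    have h1 : L ^ 2 * b ^ 2 + K * b / 2 ≤ (L ^ 2 - (K : ℝ) ^ 2) * b ^ 2 + K * b := by nlinarith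
    have h2 : 0 ≤ L ^ 2 * b ^ 2 := by positivity
    rw [thetaN, mul_pow, Real.sq_sqrt (by linarith)]
    linarith
  · refine (min_le_left _ _).trans ?_
    have h1 : 0 ≤ (L ^ 2 - (K : ℝ) ^ 2) * b ^ 2 := by
      have := hb.resolve_left h
      refine mul_nonneg ?_ (sq_nonneg _)
      nlinarith
    rw [thetaN, mul_pow, Real.sq_sqrt (by linarith)]
    linarith

/-- A sum over all other points ignores their order, so concentration for the unsorted sample
applies to the order statistics. -/
theorem sum_erase_weightedAdj {W : unitInterval → unitInterval → ℝ} {N : ℕ}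
    (x : Fin N → unitInterval) (i : Fin N) :
    ∑ j ∈ Finset.univ.erase i, weightedAdj W x i j =
      ∑ k ∈ Finset.univ.erase (Tuple.sort x i), W (x (Tuple.sort x i)) (x k) := by
  rw [Finset.sum_erase_eq_sub (Finset.mem_univ _), Finset.sum_erase_eq_sub (Finset.mem_univ _)]
  unfold weightedAdj orderStat
  rw [Equiv.sum_comp (Tuple.sort x) fun k => W (x (Tuple.sort x i)) (x k)]

/-! ### The deterministic bound on the good event -/

open Classical in
/-- The bound on the normalized Laplacian spectrum for a graph whose degrees, empirical averages and
order statistics are close to their expectations. -/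
theorem eLpNorm_muStep_sub_degreeFn_le {W : unitInterval → unitInterval → ℝ} (hW : IsGraphon W)
    {L : ℝ} {K : ℕ} {α : Fin (K + 2) → ℝ} (hLip : IsPiecewiseLipschitz W L K α)
    (hmono : ∀ y, Monotone fun x => W x y) (hη : 0 < infW W) {ν : ℝ} {N : ℕ} (hN : 0 < N)
    (hlog : 1 ≤ Real.log (2 * N / ν))
    (hb : 2 * (K : ℝ) * bN ν N ≤ 1 ∨ (K : ℝ) ≤ L)
    {x : Fin N → unitInterval} {H : SimpleGraph (Fin N)} (hx : ∀ j, x j < 1)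
    (hdeg : ∀ i, |(H.degree i : ℝ) - ∑ j ∈ Finset.univ.erase i, weightedAdj W x i j| <
      Real.sqrt (N * Real.log (2 * N / ν) / 2))
    (hsum : ∀ j, |∑ k ∈ Finset.univ.erase j, W (x j) (x k) - ((N : ℝ) - 1) * degreeFn W (x j)| <
      Real.sqrt (N * Real.log (2 * N / ν) / 2))
    (hord : ∀ i : Fin N, (i : ℝ) / N - Real.sqrt (8 * Real.log (N / ν) / (N + 1)) ≤ orderStat x i ∧
      (orderStat x i : ℝ) ≤ ((i : ℝ) + 1) / N + Real.sqrt (8 * Real.log (N / ν) / (N + 1))) :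
    eLpNorm (fun y => muStep H y - degreeFn W y) 2 volume ≤
      ENNReal.ofReal (phiN (infW W) ν N + thetaN L K ν N) := by
  have hN' : (1 : ℝ) ≤ N := by exact_mod_cast hN
  set ℓ := Real.log (2 * N / ν)
  set t := Real.sqrt (N * ℓ / 2) with ht
  have ht0 : 0 ≤ t := Real.sqrt_nonneg _
  have ht2 : t ^ 2 = N * ℓ / 2 := Real.sq_sqrt (by positivity)
  have hNl : 1 ≤ N * ℓ := by nlinarith
  have htle : t ≤ N * ℓ := by nlinarith
  have hb0 : 0 ≤ bN ν N := by unfold bN; positivity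
  have hphi0 : 0 ≤ phiN (infW W) ν N := by unfold phiN; positivity
  have htheta0 : 0 ≤ thetaN L K ν N := by unfold thetaN; positivity
  set c : Fin N → ℝ := fun i => degreeFn W (orderStat x i)
  have hc : Monotone c := (hW.monotone_degreeFn hmono).comp (Tuple.monotone_sort x)
  -- One t comes from the edges and one from the sample average; the 1 pays for replacing (N - 1)
  -- c_i by N c_i.
  have ha : ∀ i, |(H.degree i : ℝ) / N - c i| ≤ (2 * t + 1) / N := by
    intro i
    have h1 := abs_lt.1 (hdeg i)
    rw [sum_erase_weightedAdj] at h1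
    have h2 := abs_lt.1 (hsum (Tuple.sort x i))
    have h3 : 0 ≤ c i := hW.degreeFn_nonneg _
    have h4 : c i ≤ 1 := hW.degreeFn_le_one _
    have h5 : (H.degree i : ℝ) / N - c i = (H.degree i - N * c i) / N := by field_simp
    rw [h5, abs_div, Nat.abs_cast]
    gcongr
    replace h2 : - t < _ - ((N : ℝ) - 1) * c i ∧ _ - ((N : ℝ) - 1) * c i < t := h2
    rw [abs_le]
    constructor <;> linarith [h1.1, h1.2, h2.1, h2.2]
  have hspec : eLpNorm (stepFn fun i => normEig H i - c i) 2 volume ≤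
      ENNReal.ofReal (phiN (infW W) ν N) := by
    refine eLpNorm_stepFn_le _ hphi0 ((sum_sq_normEig_sub_le hN H hc ha).trans ?_)
    -- With t² = Nℓ/2, t ≤ Nℓ and ℓ ≥ 1, the bound N a² + 1 is at most 2ℓ + 4ℓ + 1/N + 1 ≤ 9ℓ.
    have h1 : 9 * ℓ ≤ N * phiN (infW W) ν N ^ 2 := by
      have h2 := mul_le_mul_of_nonneg_left (sq_phiN_ge hη (infW_le_one hW)
        (zero_le_one.trans hlog)) (zero_le_one.trans hN')
      refine le_trans (le_of_eq ?_) h2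
      rw [mul_div, mul_div_cancel₀ _ (by positivity)]
    refine le_trans ?_ h1
    have h3 : N * ((2 * t + 1) / N) ^ 2 = (4 * t ^ 2 + 4 * t + 1) / N := by field_simp; ring
    rw [h3, ht2, ← le_sub_iff_add_le, div_le_iff₀ (by positivity)]
    nlinarith
  have hstep : eLpNorm (fun y => stepFn c y - degreeFn W y) 2 volume ≤
      ENNReal.ofReal (thetaN L K ν N) := by
    refine eLpNorm_two_le_ofReal htheta0 ?_
    refine (lintegral_sq_stepFn_degreeFn_sub_le hW hLip hN (ξ := orderStat x) (fun i => hx _) hb0 ?_).trans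
      (ENNReal.ofReal_le_ofReal (min_le_sq_thetaN hb0 hb))
    intro i y hy
    have h1 := mem_Icc_of_mem_block hy
    have h2 := hord i
    have h3 : ((i : ℝ) + 1) / N = (i : ℝ) / N + 1 / N := add_div _ _ _
    rw [abs_le, bN]
    constructor <;> linarith [h1.1, h1.2, h2.1, h2.2]
  have hsplit : (fun y => muStep H y - degreeFn W y) =
      (stepFn fun i => normEig H i - c i) + fun y => stepFn c y - degreeFn W y := by
    ext y
    obtain ⟨i, hi⟩ := exists_mem_block hN y
    have h1 : muStep H y = normEig H i := stepFn_eq (normEig H) hi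
    rw [Pi.add_apply, h1, stepFn_eq _ hi, stepFn_eq _ hi]
    ring
  rw [hsplit, ENNReal.ofReal_add hphi0 htheta0]
  refine (eLpNorm_add_le (measurable_stepFn _).aestronglyMeasurable
    ((measurable_stepFn c).sub hW.measurable_degreeFn).aestronglyMeasurable (by norm_num)).trans ?_
  exact add_le_add hspec hstep

/-! ### Failure probabilities and the union bound -/

theorem mul_exp_neg_degree_eq {ν : ℝ} (hν : 0 < ν) {N : ℕ} (hN : 0 < N)
    (hlog : 0 ≤ Real.log (2 * N / ν)) :
    N * (2 * Real.exp (-2 * Real.sqrt (N * Real.log (2 * N / ν) / 2) ^ 2 / N)) = ν := by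
  have hN' : (0 : ℝ) < N := by exact_mod_cast hN
  rw [Real.sq_sqrt (by positivity),
    show -2 * (N * Real.log (2 * N / ν) / 2) / N = - Real.log (2 * N / ν) by field_simp,
    Real.exp_neg, Real.exp_log (by positivity)]
  field_simp

/-- As N/(N+1) ≥ 1/2, the exponent is at most -8 log(N/ν) ≤ -log(N/ν) - 7. The spare factor e⁻⁷ ≤
1/4 leaves ν/2, so the lower and upper thresholds together cost ν. -/
theorem mul_exp_neg_card_le {ν : ℝ} (hν : 0 < ν) {N : ℕ} (hN : 0 < N)
    (hlog : 1 ≤ Real.log (N / ν)) :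
    N * (2 * Real.exp (-2 * (N * Real.sqrt (8 * Real.log (N / ν) / (N + 1))) ^ 2 / N)) ≤ ν / 2 := by
  have hN' : (1 : ℝ) ≤ N := by exact_mod_cast hN
  have h1 : -2 * (N * Real.sqrt (8 * Real.log (N / ν) / (N + 1))) ^ 2 / N ≤
      - Real.log (N / ν) + -7 := by
    rw [mul_pow, Real.sq_sqrt (by positivity)]
    have h2 : -2 * ((N : ℝ) ^ 2 * (8 * Real.log (N / ν) / (N + 1))) / N =
        -(16 * Real.log (N / ν)) * (N / (N + 1)) := by field_simp; ring
    have h3 : (1 / 2 : ℝ) ≤ N / (N + 1) := by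
      rw [le_div_iff₀ (by linarith)]
      linarith
    rw [h2]
    nlinarith
  have h4 : Real.exp (-7) ≤ 1 / 4 := by
    rw [Real.exp_neg, inv_eq_one_div]
    have := Real.add_one_le_exp (7 : ℝ)
    exact one_div_le_one_div_of_le (by norm_num) (by linarith)
  calc _ ≤ N * (2 * (ν / N * (1 / 4))) := by
        gcongr
        refine (Real.exp_le_exp.2 h1).trans ?_
        rw [Real.exp_add, Real.exp_neg, Real.exp_log (by positivity), inv_div]
        gcongr
    _ = ν / 2 := by field_simp; ring

theorem measureReal_setOf_exists_le {Ω : Type*} [MeasurableSpace Ω] {P : Measure Ω}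
    {N : ℕ} {p : Fin N → Ω → Prop} {c : ℝ} (h : ∀ i, P.real {ω | p i ω} ≤ c) :
    P.real {ω | ∃ i, p i ω} ≤ N * c := by
  have : {ω | ∃ i, p i ω} = ⋃ i, {ω | p i ω} := by ext; simp
  rw [this]
  refine (measureReal_iUnion_fintype_le _).trans ((Finset.sum_le_sum fun i _ => h i).trans ?_)
  simp

end GraphonSpectrum

end

theorem theorem1 {Ω : Type*} [MeasurableSpace Ω] (P : Measure Ω) [IsProbabilityMeasure P]
    (W : unitInterval → unitInterval → ℝ) (hW : GraphonSpectrum.IsGraphon W)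
    (L : ℝ) (K : ℕ) (α : Fin (K + 2) → ℝ)
    (hLip : GraphonSpectrum.IsPiecewiseLipschitz W L K α)
    (hmono : ∀ y, Monotone fun x => W x y)
    (hη : 0 < GraphonSpectrum.infW W)
    (ν : ℝ) (hν : ν < Real.exp (-1))
    (N : ℕ) (hN : 0 < N) (hlarge : GraphonSpectrum.LargeEnough W L K α ν N)
    (hb : 2 * (K : ℝ) * GraphonSpectrum.bN ν N ≤ 1 ∨ (K : ℝ) ≤ L)
    (X : Fin N → Ω → unitInterval) (G : Ω → SimpleGraph (Fin N))
    (hG : GraphonSpectrum.IsSampledGraph P W X G) :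
    1 - 3 * ν ≤ P.real {ω |
      eLpNorm (fun x => GraphonSpectrum.muStep (G ω) x - GraphonSpectrum.degreeFn W x) 2 volume ≤
        ENNReal.ofReal (GraphonSpectrum.phiN (GraphonSpectrum.infW W) ν N
          + (2 / (N : ℝ)) ^ (1 / 4 : ℝ)
            * Real.sqrt (GraphonSpectrum.opNorm W + GraphonSpectrum.thetaN L K ν N)
          + GraphonSpectrum.thetaN L K ν N)} := by
  classical
  open GraphonSpectrum in
  have hN' : (1 : ℝ) ≤ N := by exact_mod_cast hN
  -- Positivity of ν comes from the tail condition N e^(-N/5) < ν.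
  have hν0 : 0 < ν := lt_of_le_of_lt (by positivity) hlarge.tail
  have hNν : Real.exp 1 ≤ N / ν := by
    rw [le_div_iff₀ hν0]
    have h1 := mul_le_mul_of_nonneg_left hν.le (Real.exp_pos 1).le
    rw [← Real.exp_add, add_neg_cancel, Real.exp_zero] at h1
    linarith
  have hlog1 : 1 ≤ Real.log (N / ν) := by
    rwa [Real.le_log_iff_exp_le (by positivity)]
  have hlog2 : 1 ≤ Real.log (2 * N / ν) := by
    refine hlog1.trans (Real.log_le_log (by positivity) ?_)
    gcongr
    linarith
  set t := Real.sqrt (N * Real.log (2 * N / ν) / 2) with ht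
  set s := Real.sqrt (8 * Real.log (N / ν) / (N + 1)) with hs
  have ht0 : 0 < t := Real.sqrt_pos.2 (by positivity)
  have hs0 : 0 < s := Real.sqrt_pos.2 (by positivity)
  set S := {ω | eLpNorm (fun x => muStep (G ω) x - degreeFn W x) 2 volume ≤
        ENNReal.ofReal (phiN (infW W) ν N
          + (2 / (N : ℝ)) ^ (1 / 4 : ℝ) * Real.sqrt (opNorm W + thetaN L K ν N)
          + thetaN L K ν N)} with hS
  let lo : Fin N → unitInterval := fun i => Set.projIcc (0 : ℝ) 1 zero_le_one ((i : ℝ) / N - s)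
  let up : Fin N → unitInterval := fun i =>
    Set.projIcc (0 : ℝ) 1 zero_le_one (((i : ℝ) + 1) / N + s)
  let A : Set Ω := {ω | ∃ i, t ≤ |((G ω).degree i : ℝ) -
      ∑ j ∈ Finset.univ.erase i, weightedAdj W (fun k => X k ω) i j|}
  let B : Set Ω := {ω | ∃ j, t ≤ |∑ k ∈ Finset.univ.erase j, W (X j ω) (X k ω) -
      ((N : ℝ) - 1) * degreeFn W (X j ω)|}
  let C : (Fin N → unitInterval) → Set Ω := fun c => {ω | ∃ i,
    N * s ≤ |((Finset.univ.filter fun j => X j ω ≤ c i).card : ℝ) - N * c i|}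
  let D : Set Ω := {ω | ¬ ∀ j, X j ω < 1}
  have hA : P.real A ≤ ν :=
    (measureReal_degree_deviation_le hW hG ht0).trans_eq
      (mul_exp_neg_degree_eq hν0 hN (zero_le_one.trans hlog2))
  have hB : P.real B ≤ ν :=
    (measureReal_setOf_exists_le fun j => measureReal_sum_sub_degreeFn_ge_le hW hG j ht0).trans_eq
      (mul_exp_neg_degree_eq hν0 hN (zero_le_one.trans hlog2))
  have hC : ∀ c, P.real (C c) ≤ ν / 2 := fun c =>
    (measureReal_setOf_exists_le fun i =>
      measureReal_card_sub_ge_le hG (c i) (by positivity)).trans (mul_exp_neg_card_le hν0 hN hlog1)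
  have hD : P.real D = 0 := by
    rw [Measure.real, ae_iff.1 (ae_latent_lt_one hG), ENNReal.toReal_zero]
  -- Covering the whole space and using subadditivity avoids any measurability claim about S.
  have hcover : Set.univ ⊆ S ∪ (A ∪ (B ∪ (C lo ∪ (C up ∪ D)))) := by
    intro ω _
    by_contra hω
    simp only [Set.mem_union, not_or] at hω
    obtain ⟨hωS, hωA, hωB, hωlo, hωup, hωD⟩ := hω
    simp only [A, B, C, D, Set.mem_ofPred_eq, not_exists, not_le, not_not] at hωA hωB hωlo hωup hωD
    refine hωS ((eLpNorm_muStep_sub_degreeFn_le hW hLip hmono hη hN hlog2 hb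
      (x := fun k => X k ω) hωD hωA hωB fun i =>
        orderStat_mem_of_card hN _ hs0 i (hωlo i) (hωup i)).trans (ENNReal.ofReal_le_ofReal ?_))
    -- The good event already gives φ(N) + ϑ(N); the operator-norm term only has to be nonnegative.
    have : 0 ≤ (2 / (N : ℝ)) ^ (1 / 4 : ℝ) * Real.sqrt (opNorm W + thetaN L K ν N) := by positivity
    linarith
  have h1 : (1 : ℝ) ≤ P.real (S ∪ (A ∪ (B ∪ (C lo ∪ (C up ∪ D))))) := by
    rw [← probReal_univ (μ := P)]
    exact measureReal_mono hcover
  have h2 := measureReal_union_le (μ := P) S (A ∪ (B ∪ (C lo ∪ (C up ∪ D))))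
  have h3 := measureReal_union_le (μ := P) A (B ∪ (C lo ∪ (C up ∪ D)))
  have h4 := measureReal_union_le (μ := P) B (C lo ∪ (C up ∪ D))
  have h5 := measureReal_union_le (μ := P) (C lo) (C up ∪ D)
  have h6 := measureReal_union_le (μ := P) (C up) D
  linarith [hC lo, hC up]
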